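/- Let $AP$ be a finite set of atomic propositions and let $\mathfrak T=(V,E,V_I,\lambda)$ be a finite transition system: $V$ is a finite set of vertices, $E\subseteq V\times V$ is such that every vertex has at least one successor, $\emptyset\neq V_I\subseteq V$, and $\lambda\colon V\to 2^{AP}$. Write $\mathrm{Succ}(v)$ for the set of successors of $v$. For nonempty $V'\subseteq V$ let $\mathrm{Tr}(\mathfrak T_{V'})\subseteq(2^{AP})^\omega$ be the set of traces $\lambda(\rho(0))\lambda(\rho(1))\cdots$ of infinite paths $\rho$ with $\rho(0)\in V'$, and let $\mathfrak T_v=\mathfrak T_{\{v\}}$. For infinite words $w_0,\dots,w_{n-1}$ over $\Sigma$ let $\mathrm{mrg}(w_0,\dots,w_{n-1})$ be the word over $\Sigma^n$ whose $r$-th letter is $(w_0(r),\dots,w_{n-1}(r))$. Let $k$ be even, $I_\forall=\{0,2,\dots,k-2\}$ and $I_\exists=\{1,3,\dots,k-1\}$. For each $j\in I_\exists$ let $\mathcal A_j$ be a deterministic one-pair Rabin automaton over the alphabet $(2^{AP})^{j+1}$, with finite state set and acceptance pair $(B,F)$: a run is accepting if it visits $B$ only finitely often and $F$ infinitely often. $\mathcal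 A_j[q]$ denotes $\mathcal A_j$ with initial state $q$. For a run $\kappa$, let $\mathrm{lastB}(\kappa)$ be $\bot$ if $\kappa$ never visits $B$, $\infty$ if it visits $B$ infinitely often, and otherwise the position of its last visit to $B$. Let $\mathrm{firstF}(\kappa)$ be the position of the first visit to $F$, and $\infty$ if there is none. The progress value $\mathrm{val}(\kappa)\in\mathbb N\cup\{\infty\}$ is $\mathrm{firstF}(\kappa)$ if $\mathrm{lastB}(\kappa)=\bot$, and $\max\{\mathrm{lastB}(\kappa),\mathrm{firstF}(\kappa)\}$ otherwise. For $j\in I_\exists$, a state $q$ of $\mathcal A_j$, $v\in V$ and traces $t_0,\dots,t_{j-1}$, let $$\mathrm{opt}_j(q,v,t_0,\dots,t_{j-1})=\min_{t\in \mathrm{Tr}(\mathfrak T_{\mathrm{Succ}(v)})}\mathrm{val}(\kappa^{t}),$$ where $\kappa^{t}$ is the run of $\mathcal A_j[q]$ on $\mathrm{mrg}(t_0,\dots,t_{j-1},t)$. Let $i\in I_\forall$, let $\bar q=(q_1,q_3,\dots,q_{i+1})$ with $q_j$ a state of $\mathcal A_j$, and let $\bar u=(v_0,\dots,v_{i+1})$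 and $\bar v=(v'_0,\dots,v'_{i+1})$ be vectors of vertices with $v'_\ell\in\mathrm{Succ}(v_\ell)$ for all $\ell\le i+1$. The progress prophecy $P_i^{\bar q}(\bar u,\bar v)$ is the set of all words $\mathrm{mrg}(t_0,t_2,\dots,t_i)$ with $t_\ell\in\mathrm{Tr}(\mathfrak T_{v'_\ell})$ for all even $\ell\le i$ such that there exist $t_\ell\in\mathrm{Tr}(\mathfrak T_{v'_\ell})$ for all odd $\ell\le i+1$ with the following property: for every odd $j\le i+1$, the run $\kappa_j$ of $\mathcal A_j[q_j]$ on $\mathrm{mrg}(t_0,\dots,t_j)$ is accepting and satisfies $\mathrm{val}(\kappa_j)=\mathrm{opt}_j(q_j,v_j,t_0,\dots,t_{j-1})$. **Lemma.** For all such $i,\bar q,\bar u,\bar v$, the language $P_i^{\bar q}(\bar u,\bar v)$ is $\omega$-regular, i.e., it is recognized by a nondeterministic Büchi automaton with finitely many states. -/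

import Mathlib

/-! ### Infinite words and omega-regular languages -/

/-- The merge (zip) of a family of infinite words: an infinite word over the product alphabet. -/
def merge {ι α : Type*} (w : ι → ℕ → α) : ℕ → ι → α := fun n j => w j n

/-- Nondeterministic Büchi automata over the alphabet `α` with state set `Q`. -/
structure BuchiAutomaton (α Q : Type*) where
  /-- the initial state -/
  start : Q
  /-- the transition relation: `step q a` is the set of `a`-successors of `q` -/
  step : Q → α → Set Q
  /-- the accepting states -/
  accepting : Set Q

/-- The language of a Büchi automaton: the infinite words that have a run visiting
accepting states infinitely often. -/
def BuchiAutomaton.language {α Q : Type*} (M : BuchiAutomaton α Q) : Set (ℕ → α) :=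
  {w | ∃ ρ : ℕ → Q, ρ 0 = M.start ∧ (∀ n, ρ (n + 1) ∈ M.step (ρ n) (w n)) ∧
    {n | ρ n ∈ M.accepting}.Infinite}

/-- A set of infinite words is omega-regular if it is the language of a nondeterministic
Büchi automaton with finitely many states. -/
def IsOmegaRegular {α : Type*} (L : Set (ℕ → α)) : Prop :=
  ∃ (Q : Type) (_ : Finite Q) (M : BuchiAutomaton α Q), M.language = L

/-! ### Transition systems -/

/-- A trace over `AP` is an infinite word over the alphabet of subsets of `AP`. -/
abbrev Trace (AP : Type*) := ℕ → Set AP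

/-- Transition systems with vertex set `V`, labelled by sets of atomic propositions. -/
structure TransitionSystem (V AP : Type*) where
  /-- the edge relation -/
  edge : V → V → Prop
  /-- the initial vertices -/
  init : Set V
  /-- the labelling of the vertices -/
  label : V → Set AP
  init_nonempty : init.Nonempty
  exists_edge : ∀ v, ∃ v', edge v v'

namespace TransitionSystem

variable {V AP : Type*}

/-- The set of successors of a vertex. -/
def succ (T : TransitionSystem V AP) (v : V) : Set V := {v' | T.edge v v'}

theorem succ_nonempty (T : TransitionSystem V AP) (v : V) : (T.succ v).Nonempty :=
  T.exists_edge v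

/-- Paths: infinite sequences of vertices along edges, starting in an initial vertex. -/
def IsPath (T : TransitionSystem V AP) (ρ : ℕ → V) : Prop :=
  ρ 0 ∈ T.init ∧ ∀ n, T.edge (ρ n) (ρ (n + 1))

/-- The set of traces of all paths of `T`. -/
def traces (T : TransitionSystem V AP) : Set (Trace AP) :=
  {t | ∃ ρ, T.IsPath ρ ∧ t = fun n => T.label (ρ n)}

/-- The system obtained from `T` by making `V'` the set of initial vertices. -/
def withInit (T : TransitionSystem V AP) (V' : Set V) (h : V'.Nonempty) :
    TransitionSystem V AP where
  edge := T.edge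
  init := V'
  label := T.label
  init_nonempty := h
  exists_edge := T.exists_edge

/-- The system `T` with the single initial vertex `v`. -/
def startAt (T : TransitionSystem V AP) (v : V) : TransitionSystem V AP :=
  T.withInit {v} (Set.singleton_nonempty v)

/-- The system `T` with the successors of `v` as initial vertices. -/
def startAtSucc (T : TransitionSystem V AP) (v : V) : TransitionSystem V AP :=
  T.withInit (T.succ v) (T.succ_nonempty v)

end TransitionSystem

/-! ### One-pair Rabin automata and the value of a run -/

/-- Deterministic Rabin automata with a single acceptance pair `(B, F)`. -/
structure OnePairRabin (α Q : Type*) where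
  /-- the initial state -/
  start : Q
  /-- the transition function -/
  step : Q → α → Q
  /-- the states that may be visited only finitely often -/
  B : Set Q
  /-- the states that must be visited infinitely often -/
  F : Set Q

namespace OnePairRabin

variable {α Q : Type*}

/-- The automaton with its initial state replaced by `q`. -/
def withStart (A : OnePairRabin α Q) (q : Q) : OnePairRabin α Q where
  start := q
  step := A.step
  B := A.B
  F := A.F

/-- The run of the automaton on an infinite word. -/
def run (A : OnePairRabin α Q) (w : ℕ → α) : ℕ → Q
  | 0 => A.start
  | n + 1 => A.step (A.run w n) (w n)

/-- A state sequence is accepting if it visits `B` only finitely often and `F` infinitely often. -/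
def IsAccepting (A : OnePairRabin α Q) (κ : ℕ → Q) : Prop :=
  {n | κ n ∈ A.B}.Finite ∧ {n | κ n ∈ A.F}.Infinite

open Classical in
/-- The position of the last visit of `κ` in `B`: `⊥` if there is no visit at all, and `∞` (`⊤`)
if there are infinitely many visits. -/
noncomputable def lastB (A : OnePairRabin α Q) (κ : ℕ → Q) : WithBot ℕ∞ :=
  if ∀ n, κ n ∉ A.B then ⊥
  else if {n | κ n ∈ A.B}.Infinite then ((⊤ : ℕ∞) : WithBot ℕ∞)
  else (((sSup {n : ℕ | κ n ∈ A.B} : ℕ) : ℕ∞) : WithBot ℕ∞)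

open Classical in
/-- The position of the first visit of `κ` in `F`, and `∞` if there is no such visit. -/
noncomputable def firstF (A : OnePairRabin α Q) (κ : ℕ → Q) : ℕ∞ :=
  if ∃ n, κ n ∈ A.F then ((sInf {n : ℕ | κ n ∈ A.F} : ℕ) : ℕ∞) else ⊤

/-- The value of a run: `firstF κ` if `lastB κ = ⊥`, and `max (lastB κ) (firstF κ)` otherwise. -/
noncomputable def val (A : OnePairRabin α Q) (κ : ℕ → Q) : ℕ∞ :=
  match A.lastB κ with
  | ⊥ => A.firstF κ
  | (b : ℕ∞) => max b (A.firstF κ)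

end OnePairRabin

/-- For fixed traces `t₀, …, tⱼ₋₁`, the smallest value of a run of `A[q]` on the merge of
`t₀, …, tⱼ₋₁, t'`, where `t'` ranges over the traces that start in a successor of `v`.
There is always such a `t'`, and every nonempty set in `ℕ∞` has a least element,
so this infimum is a minimum. -/
noncomputable def opt {V AP Q : Type*} (T : TransitionSystem V AP) {j : ℕ}
    (A : OnePairRabin (Fin (j + 1) → Set AP) Q) (q : Q) (v : V) (t : Fin j → Trace AP) : ℕ∞ :=
  ⨅ t' ∈ (T.startAtSucc v).traces,
    A.val ((A.withStart q).run (merge (Fin.snoc (α := fun _ => Trace AP) t t')))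

/-! ### Progress prophecies -/

/-- The indices `0, 2, 4, …` below `k` (those of the universally quantified trace variables). -/
abbrev IForall (k : ℕ) := {j : Fin k // Even (j : ℕ)}

/-- The indices `1, 3, 5, …` below `k` (those of the existentially quantified trace variables). -/
abbrev IExists (k : ℕ) := {j : Fin k // Odd (j : ℕ)}

theorem IForall.add_two_le {k : ℕ} (hk : Even k) (i : IForall k) : (i.1 : ℕ) + 2 ≤ k := by
  obtain ⟨⟨i, hik⟩, hi⟩ := i
  obtain ⟨a, rfl⟩ := hk
  obtain ⟨b, hb⟩ := hi
  simp only at hb ⊢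
  omega

/-- Regard an odd index below `m` as an odd index below `k`, for `m ≤ k`. -/
def IExists.castLE {m k : ℕ} (h : m ≤ k) (j : IExists m) : IExists k :=
  ⟨Fin.castLE h j.1, j.2⟩

/-- The progress prophecy for `i`, the states `q = (q₁, q₃, …, qᵢ₊₁)` and the vertices
`u = (v₀, …, vᵢ₊₁)` and `v = (v'₀, …, v'ᵢ₊₁)`. Here `IForall (i + 2)` consists of the even numbers
`0, 2, …, i` and `IExists (i + 2)` of the odd numbers `1, 3, …, i + 1`. The family `s` consists of
the traces with even index, and `t = (t₀, …, tᵢ₊₁)` extends it by the witness traces with odd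
index. -/
def progressProphecy {V AP : Type*} (T : TransitionSystem V AP) {k : ℕ} (hk : Even k)
    {Q : IExists k → Type*} (A : ∀ j : IExists k, OnePairRabin (Fin (j.1 + 1) → Set AP) (Q j))
    (i : IForall k)
    (q : ∀ j : IExists (i.1 + 2), Q (j.castLE (i.add_two_le hk)))
    (u v : Fin (i.1 + 2) → V) : Set (ℕ → IForall (i.1 + 2) → Set AP) :=
  {w | ∃ s : IForall (i.1 + 2) → Trace AP,
    w = merge s ∧
    (∀ j, s j ∈ (T.startAt (v j.1)).traces) ∧
    ∃ t : Fin (i.1 + 2) → Trace AP,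
      (∀ j : IForall (i.1 + 2), t j.1 = s j) ∧
      (∀ j : IExists (i.1 + 2), t j.1 ∈ (T.startAt (v j.1)).traces) ∧
      ∀ j : IExists (i.1 + 2),
        let Aj := A (j.castLE (i.add_two_le hk))
        let κ := (Aj.withStart (q j)).run
          (merge fun l : Fin (j.1 + 1) => t (Fin.castLE j.1.isLt l))
        Aj.IsAccepting κ ∧
        Aj.val κ = opt T Aj (q j) (u j.1) (fun l : Fin j.1 => t (Fin.castLE j.1.isLt.le l))}

/-! ### Closure properties of omega-regular languages -/

/-! The automaton reads tuples of vertices rather than labels, so that a word is a tuple of paths.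
Since `v l` is a successor of `u l`, each witness trace with odd index competes in its own minimum,
and `opt ≤ val` is automatic. Hence "accepting with optimal value" becomes: `F` is visited
infinitely often and some `n` satisfies `val < n + 1` and `n ≤ opt`
(`isAccepting_and_val_eq_opt_iff`).

By `val_lt_iff`, a value is below `n` iff `F` is visited before `n` and `B` is avoided from `n` on.
So `n ≤ opt` denies the existence of a competing path whose run does this. By König's lemma, that
denial means that a subset construction discarding bad states eventually becomes empty. A Büchi
automaton can guess `n` and wait for this (`isOmegaRegular_setOf_no_better_run`).

Intersecting over all odd indices and projecting to the labels of the even components gives the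
prophecy. -/

/-- Transporting along an equivalence with `Fin n` allows state sets from any universe. -/
theorem BuchiAutomaton.isOmegaRegular_language {α Q : Type*} [Finite Q]
    (M : BuchiAutomaton α Q) : IsOmegaRegular M.language := by
  obtain ⟨n, ⟨e⟩⟩ := Finite.exists_equiv_fin Q
  refine ⟨Fin n, inferInstance,
    ⟨e M.start, fun q a => e.symm ⁻¹' M.step (e.symm q) a, e.symm ⁻¹' M.accepting⟩, ?_⟩
  ext w
  constructor
  · rintro ⟨ρ, h0, h1, h2⟩
    exact ⟨e.symm ∘ ρ, by simp [h0], h1, h2⟩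
  · rintro ⟨ρ, h0, h1, h2⟩
    exact ⟨e ∘ ρ, by simp [h0], by simpa using h1, by simpa using h2⟩

theorem IsOmegaRegular.preimage {α β : Type*} {L : Set (ℕ → β)} (hL : IsOmegaRegular L)
    (f : α → β) : IsOmegaRegular {w : ℕ → α | f ∘ w ∈ L} := by
  obtain ⟨Q, _, M, rfl⟩ := hL
  exact ⟨Q, inferInstance, ⟨M.start, fun q a => M.step q (f a), M.accepting⟩, rfl⟩

/-- Nondeterminism guesses a preimage of each letter. -/
theorem IsOmegaRegular.image {α β : Type*} {L : Set (ℕ → α)} (hL : IsOmegaRegular L)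
    (f : α → β) : IsOmegaRegular ((fun w => f ∘ w) '' L) := by
  obtain ⟨Q, _, M, rfl⟩ := hL
  refine ⟨Q, inferInstance,
    ⟨M.start, fun q b => {q' | ∃ a, f a = b ∧ q' ∈ M.step q a}, M.accepting⟩, ?_⟩
  ext w
  constructor
  · rintro ⟨ρ, h0, h1, h2⟩
    choose v hv hv' using h1
    exact ⟨v, ⟨ρ, h0, hv', h2⟩, funext hv⟩
  · rintro ⟨v, ⟨ρ, h0, h1, h2⟩, rfl⟩
    exact ⟨ρ, h0, fun n => ⟨v n, rfl, h1 n⟩, h2⟩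

open Classical in
/-- The bookkeeping for generalized Büchi acceptance: the set of indices seen since the last
reset, where a reset happens after all indices have been seen. -/
noncomputable def seenSince {ι : Type*} (p : ℕ → Set ι) : ℕ → Set ι
  | 0 => ∅
  | n + 1 => if seenSince p n = Set.univ then ∅ else seenSince p n ∪ p n

theorem infinite_seenSince_eq_univ_iff {ι : Type*} [Finite ι] (p : ℕ → Set ι) :
    {n | seenSince p n = Set.univ}.Infinite ↔ ∀ i, {n | i ∈ p n}.Infinite := by
  constructor
  · intro h i
    rw [Set.infinite_iff_exists_gt] at h ⊢
    intro a
    obtain ⟨b, hb, hab⟩ := h a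
    obtain ⟨c, hc, hbc⟩ := h b
    by_contra! hcon
    -- The set is reset right after `b`, and `i` no longer occurs after `a < b`, so `i` is still
    -- missing at time `c`, when the set should be full.
    have key : ∀ m, b + 1 + m ≤ c → i ∉ seenSince p (b + 1 + m) := by
      intro m
      induction m with
      | zero =>
        intro _
        have hb' : seenSince p b = Set.univ := hb
        simp [seenSince, hb']
      | succ m ih =>
        intro hm
        have h1 := ih (by omega)
        rw [← add_assoc, seenSince]
        split_ifs
        · simp
        · rintro (h2 | h2)
          · exact h1 h2
          · exact absurd (hcon _ h2) (by omega)
    have hc' : seenSince p c = Set.univ := hc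
    have := key (c - (b + 1)) (by omega)
    rw [show b + 1 + (c - (b + 1)) = c by omega, hc'] at this
    exact this trivial
  · intro h
    rw [Set.infinite_iff_exists_gt]
    intro a
    by_contra! hcon
    have hne : ∀ n, a < n → seenSince p n ≠ Set.univ := fun n hn h' => by
      have := hcon n h'
      omega
    have hstep : ∀ n, a < n → seenSince p (n + 1) = seenSince p n ∪ p n := fun n hn => by
      rw [seenSince, if_neg (hne n hn)]
    -- Without resets after `a` the sets only grow. Each of the finitely many indices enters, so
    -- they fill up after all.
    have hmono : ∀ m n, a < m → m ≤ n → seenSince p m ⊆ seenSince p n := by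
      intro m n hm hmn
      induction n, hmn using Nat.le_induction with
      | base => exact subset_rfl
      | succ n hn ih => exact ih.trans (by rw [hstep n (by omega)]; exact Set.subset_union_left)
    have hex : ∀ i, ∃ n, a < n ∧ i ∈ p n := fun i => by
      obtain ⟨n, hn, han⟩ := (Set.infinite_iff_exists_gt.1 (h i)) a
      exact ⟨n, han, hn⟩
    choose N hN hpN using hex
    obtain ⟨b, hb⟩ := (Set.finite_range N).bddAbove
    refine hne (max b a + 1) (by omega) (Set.eq_univ_of_forall fun i => ?_)
    have hle : N i ≤ b := hb ⟨i, rfl⟩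
    refine hmono (N i + 1) _ (by have := hN i; omega) (by omega) ?_
    rw [hstep _ (hN i)]
    exact Or.inr (hpN i)

-- Product automaton, with the reset bookkeeping turning the family of Büchi conditions into a
-- single one.
open Classical in
theorem IsOmegaRegular.iInter {α ι : Type*} [Finite ι] {L : ι → Set (ℕ → α)}
    (hL : ∀ i, IsOmegaRegular (L i)) : IsOmegaRegular (⋂ i, L i) := by
  choose Q hQ M hM using hL
  let N : BuchiAutomaton α ((∀ i, Q i) × Set ι) :=
    { start := (fun i => (M i).start, ∅)
      step := fun x a => {y | (∀ i, y.1 i ∈ (M i).step (x.1 i) a) ∧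
        y.2 = if x.2 = Set.univ then ∅ else x.2 ∪ {i | x.1 i ∈ (M i).accepting}}
      accepting := {x | x.2 = Set.univ} }
  suffices h : N.language = ⋂ i, L i from h ▸ N.isOmegaRegular_language
  ext w
  simp only [Set.mem_iInter, ← hM]
  constructor
  · rintro ⟨ρ, h0, h1, h2⟩
    have hs : ∀ n, (ρ n).2 = seenSince (fun n => {i | (ρ n).1 i ∈ (M i).accepting}) n := by
      intro n
      induction n with
      | zero => rw [h0]; rfl
      | succ n ih => rw [(h1 n).2, ih]; rfl
    have h3 := (infinite_seenSince_eq_univ_iff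
      (fun n => {i | (ρ n).1 i ∈ (M i).accepting})).1 (by simp only [← hs]; exact h2)
    exact fun i => ⟨fun n => (ρ n).1 i, by simp [h0, N], fun n => (h1 n).1 i, h3 i⟩
  · intro h
    choose ρ h0 h1 h2 using h
    exact ⟨fun n => (fun i => ρ i n, seenSince (fun n => {i | ρ i n ∈ (M i).accepting}) n),
      by simp [h0, N, seenSince], fun n => ⟨fun i => h1 i n, rfl⟩,
      (infinite_seenSince_eq_univ_iff _).2 h2⟩

theorem IsOmegaRegular.inter {α : Type*} {L₁ L₂ : Set (ℕ → α)} (h₁ : IsOmegaRegular L₁)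
    (h₂ : IsOmegaRegular L₂) : IsOmegaRegular (L₁ ∩ L₂) := by
  rw [Set.inter_eq_iInter]
  exact IsOmegaRegular.iInter (by rintro (_ | _) <;> assumption)

theorem isOmegaRegular_setOf_path {V : Type*} [Finite V] (v : V) (E : V → V → Prop) :
    IsOmegaRegular {w : ℕ → V | w 0 = v ∧ ∀ n, E (w n) (w (n + 1))} := by
  -- The state is the last vertex read; `none` means that nothing has been read yet.
  let M : BuchiAutomaton V (Option V) :=
    { start := none
      step := fun x a => {y | y = some a ∧ match x with
        | none => a = v
        | some b => E b a}
      accepting := Set.univ }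
  suffices h : M.language = {w : ℕ → V | w 0 = v ∧ ∀ n, E (w n) (w (n + 1))} from
    h ▸ M.isOmegaRegular_language
  ext w
  constructor
  · rintro ⟨ρ, h0, h1, -⟩
    constructor
    · have := (h1 0).2
      rw [h0] at this
      exact this
    · intro n
      have := (h1 (n + 1)).2
      rw [(h1 n).1] at this
      exact this
  · rintro ⟨h0, h1⟩
    refine ⟨fun n => n.casesOn none fun n => some (w n), rfl, ?_, ?_⟩
    · rintro (_ | n)
      · exact ⟨rfl, h0⟩
      · exact ⟨rfl, h1 n⟩
    · simpa [M] using Set.infinite_univ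

/-! ### Values of runs -/

namespace OnePairRabin

variable {α Q : Type*}

theorem firstF_lt_iff (A : OnePairRabin α Q) (κ : ℕ → Q) (n : ℕ) :
    A.firstF κ < n ↔ ∃ m < n, κ m ∈ A.F := by
  rw [firstF]
  split_ifs with h
  · rw [Nat.cast_lt]
    constructor
    · exact fun h' => ⟨_, h', Nat.sInf_mem (s := {n | κ n ∈ A.F}) h⟩
    · rintro ⟨m, hm, hF⟩
      exact (Nat.sInf_le hF).trans_lt hm
  · simp only [not_top_lt, false_iff]
    rintro ⟨m, -, hF⟩
    exact h ⟨m, hF⟩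

theorem lastB_lt_iff (A : OnePairRabin α Q) (κ : ℕ → Q) (n : ℕ) :
    A.lastB κ < ((n : ℕ∞) : WithBot ℕ∞) ↔ ∀ m, n ≤ m → κ m ∉ A.B := by
  rw [lastB]
  split_ifs with h1 h2
  · simpa using fun m _ => h1 m
  · simp only [WithBot.coe_lt_coe, not_top_lt, false_iff]
    intro h
    obtain ⟨m, hm, hn⟩ := Set.infinite_iff_exists_gt.1 h2 n
    exact h m hn.le hm
  · rw [WithBot.coe_lt_coe, Nat.cast_lt]
    have hbdd := (Set.not_infinite.1 h2).bddAbove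
    push Not at h1
    constructor
    · intro h m hm hB
      exact absurd (le_csSup hbdd (show m ∈ {n | κ n ∈ A.B} from hB)) (by omega)
    · intro h
      by_contra! hcon
      exact h _ hcon (Nat.sSup_mem (s := {n | κ n ∈ A.B}) h1 hbdd)

/-- With a strict bound both cases of `val` agree, since `⊥` lies below every `n`. The result is a
condition that an automaton can check once it has guessed `n`. -/
theorem val_lt_iff (A : OnePairRabin α Q) (κ : ℕ → Q) (n : ℕ) :
    A.val κ < n ↔ (∃ m < n, κ m ∈ A.F) ∧ ∀ m, n ≤ m → κ m ∉ A.B := by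
  rw [← firstF_lt_iff, ← lastB_lt_iff, val]
  cases A.lastB κ with
  | bot => simp
  | coe b => rw [WithBot.coe_lt_coe, and_comm]; exact max_lt_iff

theorem IsAccepting.exists_val_eq {A : OnePairRabin α Q} {κ : ℕ → Q} (h : A.IsAccepting κ) :
    ∃ n : ℕ, A.val κ = n := by
  obtain ⟨b, hb⟩ := h.1.bddAbove
  obtain ⟨m, hm⟩ := h.2.nonempty
  have : A.val κ < ((max b m + 1 : ℕ) : ℕ∞) :=
    (A.val_lt_iff κ _).2 ⟨⟨m, by omega, hm⟩, fun l hl hB => by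
      have := hb hB
      omega⟩
  obtain ⟨n, hn⟩ := ENat.ne_top_iff_exists.1 this.ne_top
  exact ⟨n, hn.symm⟩

end OnePairRabin

/-! ### Automata without a good alternative run -/

/-- The subset construction: the states reachable along `w` from `I` by the relation `R`. -/
def reach {α P : Type*} (R : α → P → Set P) (w : ℕ → α) (I : Set P) : ℕ → Set P
  | 0 => I
  | n + 1 => ⋃ p ∈ reach R w I n, R (w n) p

theorem mem_reach_iff {α P : Type*} (R : α → P → Set P) (w : ℕ → α) (I : Set P) (n : ℕ) (p : P) :
    p ∈ reach R w I n ↔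
      ∃ r : ℕ → P, r 0 ∈ I ∧ (∀ m < n, r (m + 1) ∈ R (w m) (r m)) ∧ r n = p := by
  induction n generalizing p with
  | zero => exact ⟨fun h => ⟨fun _ => p, h, by simp, rfl⟩, by rintro ⟨r, h, -, rfl⟩; exact h⟩
  | succ n ih =>
    simp only [reach, Set.mem_iUnion, ih]
    constructor
    · rintro ⟨_, ⟨r, h0, h1, rfl⟩, hp⟩
      refine ⟨fun m => if m ≤ n then r m else p, by simpa using h0, fun m hm => ?_, by simp⟩
      rcases (Nat.lt_succ_iff.1 hm).lt_or_eq with hm' | rfl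
      · simpa [hm'.le, Nat.succ_le_iff.2 hm'] using h1 m hm'
      · simpa using hp
    · rintro ⟨r, h0, h1, rfl⟩
      exact ⟨r n, ⟨r, h0, fun m hm => h1 m (by omega), rfl⟩, h1 n (by omega)⟩

/-- König's lemma: in a finite state space there is an infinite run if the set of
reachable states is never empty. -/
theorem exists_run_of_reach_nonempty {α P : Type*} [Finite P] (R : α → P → Set P) (w : ℕ → α)
    (I : Set P) (h : ∀ n, (reach R w I n).Nonempty) :
    ∃ r : ℕ → P, r 0 ∈ I ∧ ∀ m, r (m + 1) ∈ R (w m) (r m) := by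
  -- Live states at time `m` start arbitrarily long finite runs; only the steps from `m` up to `n`
  -- are constrained.
  let live : ℕ → Set P := fun m => {p | ∀ n, ∃ r : ℕ → P, r m = p ∧
    ∀ l, m ≤ l → l < n → r (l + 1) ∈ R (w l) (r l)}
  -- If every state of `S` failed at some length, a common bound for these finitely many lengths
  -- would contradict the hypothesis.
  have pigeon : ∀ (m : ℕ) (S : Set P), (∀ n, ∃ r : ℕ → P, r m ∈ S ∧
      ∀ l, m ≤ l → l < n → r (l + 1) ∈ R (w l) (r l)) → ∃ p ∈ S, p ∈ live m := by
    intro m S hS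
    by_contra! hcon
    have : ∀ p, ∃ n, p ∈ S → ¬ ∃ r : ℕ → P, r m = p ∧
        ∀ l, m ≤ l → l < n → r (l + 1) ∈ R (w l) (r l) := by
      intro p
      by_cases hp : p ∈ S
      · obtain ⟨n, hn⟩ := not_forall.1 (hcon p hp)
        exact ⟨n, fun _ => hn⟩
      · exact ⟨0, fun h => absurd h hp⟩
    choose N hN using this
    obtain ⟨b, hb⟩ := (Set.finite_range N).bddAbove
    obtain ⟨r, hr, hr'⟩ := hS b
    exact hN (r m) hr ⟨r, rfl, fun l hl hln => hr' l hl (hln.trans_le (hb ⟨_, rfl⟩))⟩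
  obtain ⟨p₀, hp₀, hl₀⟩ := pigeon 0 I fun n => by
    obtain ⟨p, hp⟩ := h n
    obtain ⟨r, h0, h1, -⟩ := (mem_reach_iff R w I n p).1 hp
    exact ⟨r, h0, fun l _ hl => h1 l hl⟩
  have hnext : ∀ (m : ℕ) (p : live m), ∃ p' : live (m + 1), p'.1 ∈ R (w m) p.1 := by
    rintro m ⟨p, hp⟩
    obtain ⟨p', hp', hl'⟩ := pigeon (m + 1) (R (w m) p) fun n => by
      -- The maximum ensures that the step from `m` to `m + 1` is constrained even for small `n`.
      obtain ⟨r, rfl, hr⟩ := hp (max n (m + 1))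
      exact ⟨r, hr m le_rfl (by omega), fun l hl hln => hr l (by omega) (by omega)⟩
    exact ⟨⟨p', hl'⟩, hp'⟩
  choose next hnext using hnext
  let r : ∀ m, live m := fun m => m.rec ⟨p₀, hl₀⟩ fun m p => next m p
  exact ⟨fun m => (r m).1, hp₀, fun m => hnext m (r m)⟩

theorem exists_run_iff_reach_nonempty {α P : Type*} [Finite P] (R : α → P → Set P) (w : ℕ → α)
    (I : Set P) : (∃ r : ℕ → P, r 0 ∈ I ∧ ∀ m, r (m + 1) ∈ R (w m) (r m)) ↔
      ∀ n, (reach R w I n).Nonempty :=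
  ⟨fun ⟨r, h0, h1⟩ n => ⟨r n, (mem_reach_iff R w I n _).2 ⟨r, h0, fun m _ => h1 m, rfl⟩⟩,
    exists_run_of_reach_nonempty R w I⟩

theorem reach_eq_empty_of_le {α P : Type*} (R : α → P → Set P) (w : ℕ → α) (I : Set P)
    {m n : ℕ} (hmn : m ≤ n) (h : reach R w I m = ∅) : reach R w I n = ∅ := by
  induction n, hmn using Nat.le_induction with
  | base => exact h
  | succ n _ ih => simp [reach, ih]

/-- A run that is in `F` at time `n` and avoids `B` from then on exists if and only if the sets
obtained from the subset construction by discarding states outside `F` at time `n` and states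
in `B` afterwards are all nonempty. -/
theorem exists_run_avoiding_iff {α P : Type*} [Finite P] (R : α → P → Set P) (w : ℕ → α)
    (I F B : Set P) (n : ℕ) :
    (∃ r : ℕ → P, r 0 ∈ I ∧ (∀ m, r (m + 1) ∈ R (w m) (r m)) ∧ r n ∈ F ∧
      ∀ m, n ≤ m → r m ∉ B) ↔
    ∀ l, (reach (fun a p => R a p \ B) (fun m => w (n + m))
      (reach R w I n ∩ (F \ B)) l).Nonempty := by
  rw [← exists_run_iff_reach_nonempty]
  constructor
  · rintro ⟨r, h0, h1, hF, hB⟩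
    exact ⟨fun m => r (n + m),
      ⟨(mem_reach_iff R w I n _).2 ⟨r, h0, fun m _ => h1 m, rfl⟩, hF, hB n le_rfl⟩,
      fun m => ⟨h1 (n + m), hB _ (by omega)⟩⟩
  · rintro ⟨r, ⟨h0, hF, hB⟩, h1⟩
    obtain ⟨r', h0', h1', h2'⟩ := (mem_reach_iff R w I n _).1 h0
    -- The finite run reaching the filtered set is glued at time `n` to the infinite run avoiding
    -- `B`.
    refine ⟨fun m => if m ≤ n then r' m else r (m - n), by simpa using h0', fun m => ?_,
      by simpa [h2'] using hF, fun m hm => ?_⟩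
    · rcases lt_trichotomy m n with hm | rfl | hm
      · simpa [hm.le, Nat.succ_le_iff.2 hm] using h1' m hm
      · simpa [h2'] using (h1 0).1
      · have := (h1 (m - n)).1
        rw [show n + (m - n) = m by omega] at this
        simpa [show ¬ m ≤ n by omega, show ¬ m + 1 ≤ n by omega,
          show m + 1 - n = m - n + 1 by omega] using this
    · rcases hm.eq_or_lt with rfl | hm
      · simpa [h2'] using hB
      · have := (h1 (m - n - 1)).2
        rw [show m - n - 1 + 1 = m - n by omega] at this
        simpa [show ¬ m ≤ n by omega] using this

/-- The words whose run `κ` in a finite deterministic automaton visits `G` infinitely often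
and, for some `n`, is in `F` at time `n + 1` and avoids `B` from then on, while no run of a finite
nondeterministic automaton is in `F'` at time `n` and avoids `B'` from then on. -/
theorem isOmegaRegular_setOf_no_better_run {α D P : Type*} [Finite D] [Finite P]
    (δ : D → α → D) (d₀ : D) (G F B : Set D) (R : α → P → Set P) (I F' B' : Set P) :
    IsOmegaRegular {w : ℕ → α | ∃ κ : ℕ → D, κ 0 = d₀ ∧ (∀ n, κ (n + 1) = δ (κ n) (w n)) ∧
      {n | κ n ∈ G}.Infinite ∧ ∃ n, κ (n + 1) ∈ F ∧ (∀ m, n + 1 ≤ m → κ m ∉ B) ∧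
      ¬ ∃ r : ℕ → P, r 0 ∈ I ∧ (∀ m, r (m + 1) ∈ R (w m) (r m)) ∧ r n ∈ F' ∧
        ∀ m, n ≤ m → r m ∉ B'} := by
  -- The flag turns true on the guessed transition from `n` to `n + 1`. That transition filters the
  -- competitors at its source (time `n`) and checks the deterministic run at its target (time `n +
  -- 1`), which accounts for the different thresholds. An empty set stays empty, so infinitely many
  -- visits to `G` with empty set need no second Büchi condition.
  let M : BuchiAutomaton α (D × Set P × Bool) :=
    { start := (d₀, I, false)
      step := fun x a => {y | y.1 = δ x.1 a ∧ match x.2.2 with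
        | false => (y.2.1 = (⋃ p ∈ x.2.1, R a p) ∧ y.2.2 = false) ∨
            (y.2.1 = (⋃ p ∈ x.2.1 ∩ (F' \ B'), R a p \ B') ∧ y.2.2 = true ∧ y.1 ∈ F ∧ y.1 ∉ B)
        | true => y.2.1 = (⋃ p ∈ x.2.1, R a p \ B') ∧ y.2.2 = true ∧ y.1 ∉ B}
      accepting := {x | x.1 ∈ G ∧ x.2.1 = ∅ ∧ x.2.2 = true} }
  convert M.isOmegaRegular_language using 1
  ext w
  constructor
  · rintro ⟨κ, h0, h1, hG, n, hF, hB, hr⟩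
    rw [exists_run_avoiding_iff] at hr
    push Not at hr
    obtain ⟨l, hl⟩ := hr
    set Z := reach (fun a p => R a p \ B') (fun m => w (n + m)) (reach R w I n ∩ (F' \ B')) with hZ
    refine ⟨fun m => if m ≤ n then (κ m, reach R w I m, false) else (κ m, Z (m - n), true),
      by simp [h0, M, reach], fun m => ?_, ?_⟩
    · rcases lt_trichotomy m n with hm | rfl | hm
      · simpa [M, hm.le, Nat.succ_le_iff.2 hm, reach] using h1 m
      · simpa [M, hZ, reach, h1 m] using
          ⟨by simpa [h1 m] using hF, by simpa [h1 m] using hB (m + 1) le_rfl⟩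
      · have hZ' : Z (m + 1 - n) = ⋃ p ∈ Z (m - n), R (w m) p \ B' := by
          rw [show m + 1 - n = m - n + 1 by omega, hZ, reach, show n + (m - n) = m by omega]
        simp only [M, show ¬ m ≤ n by omega, show ¬ m + 1 ≤ n by omega, if_false]
        exact ⟨h1 m, hZ', rfl, hB _ (by omega)⟩
    · rw [Set.infinite_iff_exists_gt] at hG ⊢
      intro a
      -- Beyond `n + l` the set of competitors has died out.
      obtain ⟨b, hb, hab⟩ := hG (max a (n + l))
      refine ⟨b, ?_, by omega⟩
      have : ¬ b ≤ n := by omega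
      simp only [M, Set.mem_ofPred_eq, this, if_false]
      exact ⟨hb, reach_eq_empty_of_le _ _ _ (by omega) hl, trivial⟩
  · rintro ⟨ρ, h0, h1, h2⟩
    have hκ : ∀ m, (ρ (m + 1)).1 = δ (ρ m).1 (w m) := fun m => (h1 m).1
    have hex : ∃ m, (ρ m).2.2 = true := by
      obtain ⟨m, hm⟩ := h2.nonempty
      exact ⟨m, hm.2.2⟩
    classical
    obtain ⟨n, hn⟩ : ∃ n, Nat.find hex = n + 1 := by
      refine Nat.exists_eq_succ_of_ne_zero fun h => ?_
      have := Nat.find_spec hex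
      rw [h, h0] at this
      exact Bool.false_ne_true this
    have hfalse : ∀ m, m ≤ n → (ρ m).2.2 = false := fun m hm => by
      simpa using Nat.find_min hex (m := m) (by omega)
    have htrue : (ρ (n + 1)).2.2 = true := hn ▸ Nat.find_spec hex
    have hX : ∀ m, m ≤ n → (ρ m).2.1 = reach R w I m := by
      intro m
      induction m with
      | zero => intro _; rw [h0]; rfl
      | succ m ih =>
        intro hm
        have hs := (h1 m).2
        rw [hfalse m (by omega)] at hs
        rcases hs with hs | hs
        · rw [hs.1, ih (by omega)]; rfl
        · rw [hfalse _ hm] at hs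
          exact absurd hs.2.1 Bool.false_ne_true
    have hs := (h1 n).2
    rw [hfalse n le_rfl] at hs
    obtain ⟨hZn, -, hF, hB⟩ := hs.resolve_left (by simp [htrue])
    have hZ : ∀ m, (ρ (n + 1 + m)).2.1 = reach (fun a p => R a p \ B') (fun m => w (n + m))
        (reach R w I n ∩ (F' \ B')) (m + 1) ∧ (ρ (n + 1 + m)).2.2 = true ∧
        (ρ (n + 1 + m)).1 ∉ B := by
      intro m
      induction m with
      | zero =>
        refine ⟨?_, htrue, hB⟩
        rw [add_zero, hZn, hX n le_rfl]
        rfl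
      | succ m ih =>
        have hs := (h1 (n + 1 + m)).2
        rw [ih.2.1] at hs
        refine ⟨?_, hs.2⟩
        rw [← add_assoc, hs.1, ih.1, show n + 1 + m = n + (m + 1) by omega]
        rfl
    refine ⟨fun m => (ρ m).1, congrArg Prod.fst h0, hκ, h2.mono fun m hm => hm.1, n, hF, fun m hm => ?_, ?_⟩
    · have := (hZ (m - (n + 1))).2.2
      rwa [show n + 1 + (m - (n + 1)) = m by omega] at this
    · rw [exists_run_avoiding_iff]
      intro hne
      obtain ⟨m, hm, hnm⟩ := Set.infinite_iff_exists_gt.1 h2 (n + 1)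
      have := (hZ (m - (n + 1))).1
      rw [show n + 1 + (m - (n + 1)) = m by omega, hm.2.1] at this
      exact (hne _).ne_empty this.symm

/-! ### Optimal runs -/

/-- Whether a sequence of states has visited `F` strictly before the current position. -/
def visited {Q : Type*} (F : Set Q) (κ : ℕ → Q) (n : ℕ) : Prop := ∃ m < n, κ m ∈ F

theorem visited_succ {Q : Type*} (F : Set Q) (κ : ℕ → Q) (n : ℕ) :
    visited F κ (n + 1) ↔ visited F κ n ∨ κ n ∈ F := by
  simp only [visited, Nat.lt_succ_iff_lt_or_eq, or_and_right, exists_or, exists_eq_left]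

theorem eq_visited {Q : Type*} {F : Set Q} {κ : ℕ → Q} {f : ℕ → Prop} (h0 : f 0 = False)
    (h1 : ∀ n, f (n + 1) = (f n ∨ κ n ∈ F)) (n : ℕ) : f n = visited F κ n := by
  induction n with
  | zero => simp [h0, visited]
  | succ n ih => rw [h1, ih, visited_succ]

theorem merge_snoc {AP : Type*} {j : ℕ} (t : Fin j → Trace AP) (t' : Trace AP) (n : ℕ) :
    merge (Fin.snoc (α := fun _ => Trace AP) t t') n =
      Fin.snoc (α := fun _ => Set AP) (fun l => t l n) (t' n) := by
  ext l : 1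
  refine Fin.lastCases ?_ (fun l => ?_) l <;> simp [merge]

theorem OnePairRabin.eq_run {α Q : Type*} {A : OnePairRabin α Q} {w : ℕ → α} {κ : ℕ → Q}
    (h0 : κ 0 = A.start) (h1 : ∀ n, κ (n + 1) = A.step (κ n) (w n)) : κ = A.run w := by
  ext n
  induction n with
  | zero => exact h0
  | succ n ih => rw [h1, ih]; rfl

theorem natCast_le_opt_iff {V AP Q : Type*} (T : TransitionSystem V AP) {j : ℕ}
    (A : OnePairRabin (Fin (j + 1) → Set AP) Q) (q : Q) (v : V) (t : Fin j → Trace AP) (n : ℕ) :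
    n ≤ opt T A q v t ↔ ∀ t' ∈ (T.startAtSucc v).traces,
      ¬ A.val ((A.withStart q).run (merge (Fin.snoc (α := fun _ => Trace AP) t t'))) < n := by
  simp only [opt, le_iInf_iff, not_lt]

theorem opt_le {V AP Q : Type*} (T : TransitionSystem V AP) {j : ℕ}
    (A : OnePairRabin (Fin (j + 1) → Set AP) Q) (q : Q) (v : V) (t : Fin j → Trace AP)
    {t' : Trace AP} (ht' : t' ∈ (T.startAtSucc v).traces) :
    opt T A q v t ≤
      A.val ((A.withStart q).run (merge (Fin.snoc (α := fun _ => Trace AP) t t'))) :=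
  iInf₂_le t' ht'

/-- A run is accepting and of optimal value if it visits `F` infinitely often and, for some `n`, its
value is at most `n` and no run has a value less than `n`. -/
theorem isAccepting_and_val_eq_opt_iff {V AP Q : Type*} (T : TransitionSystem V AP) {j : ℕ}
    (A : OnePairRabin (Fin (j + 1) → Set AP) Q) (q : Q) (v : V) (t : Fin j → Trace AP)
    {κ : ℕ → Q} (hκ : opt T A q v t ≤ A.val κ) :
    (A.IsAccepting κ ∧ A.val κ = opt T A q v t) ↔
      {m | κ m ∈ A.F}.Infinite ∧ ∃ n : ℕ, A.val κ < (n + 1 : ℕ) ∧ n ≤ opt T A q v t := by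
  constructor
  · rintro ⟨hacc, hval⟩
    -- The guess is the value itself, finite because the run accepts.
    obtain ⟨n, hn⟩ := hacc.exists_val_eq
    exact ⟨hacc.2, n, by rw [hn]; exact_mod_cast Nat.lt_succ_self n, (hval ▸ hn).ge⟩
  · rintro ⟨hF, n, hlt, hle⟩
    refine ⟨⟨?_, hF⟩, le_antisymm ?_ hκ⟩
    · have := ((A.val_lt_iff κ _).1 hlt).2
      exact (Set.finite_lt_nat (n + 1)).subset fun m hm => by
        by_contra hcon
        exact this m (not_lt.1 hcon) hm
    · refine le_trans ?_ hle
      rw [Nat.cast_succ] at hlt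
      exact Order.le_of_lt_add_one hlt

/-- A `Prop` flag recording an earlier visit to `F` makes the bound on `firstF` a property of the
current state. Competitors are triples of path vertex, automaton state and flag; their last input
component is the label of their own vertex. -/
theorem isOmegaRegular_setOf_exists_val_lt_and_le_opt {V AP Q : Type*} [Finite V] [Finite Q]
    (T : TransitionSystem V AP) {j : ℕ} (A : OnePairRabin (Fin (j + 1) → Set AP) Q)
    (q : Q) (v : V) :
    IsOmegaRegular {x : ℕ → Fin (j + 1) → V |
      {m | (A.withStart q).run (merge fun l n => T.label (x n l)) m ∈ A.F}.Infinite ∧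
      ∃ n : ℕ, A.val ((A.withStart q).run (merge fun l n => T.label (x n l))) < (n + 1 : ℕ) ∧
        n ≤ opt T A q v fun l n => T.label (x n l.castSucc)} := by
  convert isOmegaRegular_setOf_no_better_run (α := Fin (j + 1) → V) (D := Q × Prop)
    (P := V × Q × Prop) (fun p a => (A.step p.1 fun l => T.label (a l), p.2 ∨ p.1 ∈ A.F))
    (q, False) {p | p.1 ∈ A.F} {p | p.2} {p | p.1 ∈ A.B}
    (fun a p => {p' | T.edge p.1 p'.1 ∧
      p'.2.1 = A.step p.2.1 (Fin.snoc (α := fun _ => Set AP)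
        (fun l => T.label (a l.castSucc)) (T.label p.1)) ∧
      p'.2.2 = (p.2.2 ∨ p.2.1 ∈ A.F)})
    {p | p.1 ∈ T.succ v ∧ p.2.1 = q ∧ p.2.2 = False} {p | p.2.2} {p | p.2.1 ∈ A.B} using 1
  ext x
  have hopt : ∀ n : ℕ, n ≤ opt T A q v (fun l n => T.label (x n l.castSucc)) ↔
      ¬ ∃ r : ℕ → V × Q × Prop, ((r 0).1 ∈ T.succ v ∧ (r 0).2.1 = q ∧ (r 0).2.2 = False) ∧
        (∀ m, T.edge (r m).1 (r (m + 1)).1 ∧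
          (r (m + 1)).2.1 = A.step (r m).2.1 (Fin.snoc (α := fun _ => Set AP)
            (fun l => T.label (x m l.castSucc)) (T.label (r m).1)) ∧
          (r (m + 1)).2.2 = ((r m).2.2 ∨ (r m).2.1 ∈ A.F)) ∧
        (r n).2.2 ∧ ∀ m, n ≤ m → (r m).2.1 ∉ A.B := by
    intro n
    rw [natCast_le_opt_iff, iff_comm, ← not_iff_not, not_not]
    simp only [not_forall, not_not, exists_prop, OnePairRabin.val_lt_iff]
    constructor
    · rintro ⟨r, ⟨h0, h1, h2⟩, hr, hF, hB⟩
      have hκ : (fun m => (r m).2.1) = (A.withStart q).run (merge (Fin.snoc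
          (α := fun _ => Trace AP) (fun l n => T.label (x n l.castSucc))
            fun m => T.label (r m).1)) :=
        OnePairRabin.eq_run h1 fun m => by rw [merge_snoc]; exact (hr m).2.1
      refine ⟨fun m => T.label (r m).1, ⟨fun m => (r m).1, ⟨h0, fun m => (hr m).1⟩, rfl⟩, ?_⟩
      rw [← hκ]
      refine ⟨?_, hB⟩
      have := eq_visited (F := A.F) (κ := fun m => (r m).2.1)
        (f := fun m => (r m).2.2) h2 (fun m => (hr m).2.2) n
      exact this.mp hF
    · rintro ⟨_, ⟨ρ, ⟨h0, h1⟩, rfl⟩, hF, hB⟩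
      set κ := (A.withStart q).run (merge (Fin.snoc (α := fun _ => Trace AP)
        (fun l n => T.label (x n l.castSucc)) fun m => T.label (ρ m))) with hκ
      refine ⟨fun m => (ρ m, κ m, visited A.F κ m), ⟨h0, rfl, by simp [visited]⟩,
        fun m => ⟨h1 m, ?_, propext (visited_succ _ _ _)⟩, hF, hB⟩
      exact congrArg (A.step (κ m)) (merge_snoc _ _ m)
  simp only [Set.mem_ofPred_eq, hopt, OnePairRabin.val_lt_iff]
  set κ := (A.withStart q).run (merge fun l n => T.label (x n l)) with hκ
  constructor
  · rintro ⟨hF, n, ⟨h1, h2⟩, h3⟩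
    exact ⟨fun m => (κ m, visited A.F κ m), by simp [visited, hκ, OnePairRabin.run,
      OnePairRabin.withStart], fun m => Prod.ext rfl (propext (visited_succ _ _ _)), hF,
      n, h1, h2, h3⟩
  · rintro ⟨κ', h0, h1, hF, n, h2, h3, h4⟩
    have hκ' : (fun m => (κ' m).1) = κ :=
      OnePairRabin.eq_run (congrArg Prod.fst h0) fun m => congrArg Prod.fst (h1 m)
    have hv := eq_visited (F := A.F) (κ := fun m => (κ' m).1) (f := fun m => (κ' m).2)
      (congrArg Prod.snd h0)
      (fun m => congrArg Prod.snd (h1 m)) (n + 1)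
    rw [← hκ']
    exact ⟨hF, n, ⟨hv.mp h2, h3⟩, h4⟩

/-- All progress prophecies are omega-regular languages. -/
theorem mainTheorem4 {V AP : Type*} [Finite V] [Finite AP] (T : TransitionSystem V AP)
    {k : ℕ} (hk : Even k) {Q : IExists k → Type*} [∀ j, Finite (Q j)]
    (A : ∀ j : IExists k, OnePairRabin (Fin (j.1 + 1) → Set AP) (Q j))
    (i : IForall k)
    (q : ∀ j : IExists (i.1 + 2), Q (j.castLE (i.add_two_le hk)))
    (u v : Fin (i.1 + 2) → V) (huv : ∀ l, v l ∈ T.succ (u l)) :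
    IsOmegaRegular (progressProphecy T hk A i q u v) := by
  have hpath := IsOmegaRegular.iInter fun l : Fin (i.1 + 2) =>
    (isOmegaRegular_setOf_path (v l) T.edge).preimage fun x : Fin (i.1 + 2) → V => x l
  have hopt := IsOmegaRegular.iInter fun j : IExists (i.1 + 2) =>
    (isOmegaRegular_setOf_exists_val_lt_and_le_opt T (A (j.castLE (i.add_two_le hk))) (q j)
      (u j.1)).preimage fun (x : Fin (i.1 + 2) → V) l => x (Fin.castLE j.1.isLt l)
  convert (hpath.inter hopt).image
    fun (x : Fin (i.1 + 2) → V) (l : IForall (i.1 + 2)) => T.label (x l.1) using 1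
  -- The path with index `j` starts in a successor of `u j`, so its trace is itself a candidate in
  -- the minimum.
  have key : ∀ ρ : Fin (i.1 + 2) → ℕ → V,
      (∀ l, ρ l 0 = v l ∧ ∀ n, T.edge (ρ l n) (ρ l (n + 1))) → ∀ j : IExists (i.1 + 2),
      opt T (A (j.castLE (i.add_two_le hk))) (q j) (u j.1)
          (fun l n => T.label (ρ (Fin.castLE j.1.isLt.le l) n)) ≤
        (A (j.castLE (i.add_two_le hk))).val (((A (j.castLE (i.add_two_le hk))).withStart
          (q j)).run (merge fun l n => T.label (ρ (Fin.castLE j.1.isLt l) n))) := by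
    intro ρ hρ j
    refine (opt_le T _ _ _ _ (t' := fun n => T.label (ρ j.1 n))
      ⟨ρ j.1, ⟨(hρ j.1).1 ▸ huv j.1, (hρ j.1).2⟩, rfl⟩).trans_eq ?_
    congr 3
    ext l : 1
    refine Fin.lastCases ?_ (fun l => ?_) l
    · simp; rfl
    · simp; rfl
  ext w
  simp only [Set.mem_image, Set.mem_inter_iff, Set.mem_iInter]
  constructor
  · rintro ⟨s, rfl, hs, t, hts, ht, hj⟩
    have htr : ∀ l, t l ∈ (T.startAt (v l)).traces := fun l => by
      rcases Nat.even_or_odd l.1 with hl | hl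
      · exact hts ⟨l, hl⟩ ▸ hs ⟨l, hl⟩
      · exact ht ⟨l, hl⟩
    choose ρ hρ hρt using htr
    obtain rfl : t = fun l n => T.label (ρ l n) := funext hρt
    refine ⟨fun n l => ρ l n, ⟨hρ, fun j => ?_⟩, ?_⟩
    · exact (isAccepting_and_val_eq_opt_iff T _ _ _ _ (key ρ hρ j)).1 (hj j)
    · ext n l : 2
      exact congrFun (hts l) n
  · rintro ⟨x, ⟨hx, hj⟩, rfl⟩
    refine ⟨fun l n => T.label (x n l.1), rfl, fun l => ⟨_, hx l.1, rfl⟩,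
      fun l n => T.label (x n l), fun _ => rfl, fun l => ⟨_, hx l.1, rfl⟩, fun j => ?_⟩
    exact (isAccepting_and_val_eq_opt_iff T _ _ _ _ (key (fun l n => x n l) hx j)).2 (hj j)
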